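/- Let $n\ge 1$, let $0<a_1\le\dots\le a_n$ be real numbers and $A=\mathrm{diag}(a_1,\dots,a_n)$. Let $\langle\cdot,\cdot\rangle$ be the standard Hermitian product on $\mathbb C^n$, antilinear in the first argument, and put $\langle v,w\rangle_A=\langle Av,w\rangle$. Let $$E(A)=\Big\{z\in\mathbb C^n : \tfrac{|z_1|^2}{a_1}+\dots+\tfrac{|z_n|^2}{a_n}=1\Big\},$$ with the Riemannian metric $g$ and the one-form $\alpha$ obtained by restricting $\mathrm{Re}\langle\cdot,\cdot\rangle$ and $\alpha_z=\tfrac12\mathrm{Im}\langle z,\cdot\rangle$ to $E(A)$. On the unit sphere $\mathbb S^{2n-1}\subset\mathbb C^n$, let $g_A$ and $\alpha_A$ be the restrictions of $\mathrm{Re}\langle\cdot,\cdot\rangle_A$ and $(\alpha_A)_z=\tfrac12\mathrm{Im}\langle z,\cdot\rangle_A$. An exact magnetic system $(M,g,\mathrm d\alpha)$ on a closed manifold $M$, given by a Riemannian metric $g$ and a one-form $\alpha$, is called Killing if the vector field $X$ that is $g$-dual to $\alpha$ (that is, $g(X,\cdot)=\alpha$) is a Killing vector field, i.e. its flow acts by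 isometries of $(M,g)$. Its Mañé critical value $c(M,g,\mathrm d\alpha)$ is the infimum of all $\kappa\in\mathbb R$ such that $$\int_0^T\Big(\tfrac12|\dot\gamma(t)|^2-\alpha_{\gamma(t)}(\dot\gamma(t))+\kappa\Big)\,\mathrm dt\ \ge\ 0\qquad\text{for all } T>0 \text{ and all } \gamma\in C^\infty(\mathbb R/T\mathbb Z,M).$$ Then the magnetic system $(\mathbb S^{2n-1},g_A,\mathrm d\alpha_A)$ is Killing, the magnetic system $(E(A),g,\mathrm d\alpha)$ is Killing, and $$c(E(A),g,\mathrm d\alpha)=\tfrac12\|\alpha\|_\infty^2=\frac{a_n}{8},$$ where $\|\alpha\|_\infty=\sup_{q\in E(A)}\,\sup\{|\alpha_q(v)| : v\in T_qE(A),\ g_q(v,v)\le 1\}$. -/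

import Mathlib

open Bundle Module
open scoped Manifold ContDiff

namespace Magnetic

noncomputable section

section General

variable {d : ℕ} {M : Type*} [TopologicalSpace M] [ChartedSpace (EuclideanSpace ℝ (Fin d)) M]

/-- An exact magnetic system `(M, g, dα)`: a smooth Riemannian metric `g` and a smooth one-form
`α` (the magnetic potential) on a smooth boundaryless `d`-dimensional manifold `M`. -/
structure ExactMagneticSystem (d : ℕ) (M : Type*) [TopologicalSpace M]
    [ChartedSpace (EuclideanSpace ℝ (Fin d)) M] [IsManifold (𝓡 d) ∞ M] where
  metric : ContMDiffRiemannianMetric (𝓡 d) ∞ (EuclideanSpace ℝ (Fin d))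
    (fun x : M => TangentSpace (𝓡 d) x)
  potential (x : M) : TangentSpace (𝓡 d) x →L[ℝ] ℝ
  contMDiff_potential : ContMDiff (𝓡 d) ((𝓡 d).prod 𝓘(ℝ, EuclideanSpace ℝ (Fin d) →L[ℝ] ℝ)) ∞
    (fun x => TotalSpace.mk' (EuclideanSpace ℝ (Fin d) →L[ℝ] ℝ)
      (E := fun x : M => TangentSpace (𝓡 d) x →L[ℝ] ℝ) x (potential x))

/-- A vector field `X` on the Riemannian manifold `(M, g)` is Killing if it has a global flow by
diffeomorphisms of `M` and the flow acts by isometries of `g`. -/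
def IsKillingField [IsManifold (𝓡 d) ∞ M]
    (g : ContMDiffRiemannianMetric (𝓡 d) ∞ (EuclideanSpace ℝ (Fin d))
      (fun x : M => TangentSpace (𝓡 d) x))
    (X : ∀ x : M, TangentSpace (𝓡 d) x) : Prop :=
  ∃ Φ : ℝ → Diffeomorph (𝓡 d) (𝓡 d) M M ∞,
    (∀ x, Φ 0 x = x) ∧
    (∀ x, IsMIntegralCurve (I := 𝓡 d) (fun t => Φ t x) X) ∧
    ∀ (t : ℝ) (x : M) (v w : TangentSpace (𝓡 d) x),
      g.inner (Φ t x) (mfderiv (𝓡 d) (𝓡 d) (Φ t) x v) (mfderiv (𝓡 d) (𝓡 d) (Φ t) x w)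
        = g.inner x v w

namespace ExactMagneticSystem

variable [IsManifold (𝓡 d) ∞ M] (S : ExactMagneticSystem d M)

/-- `X` is the `g`-dual vector field of `α`, that is `g(X, ·) = α`. -/
def IsDualField (X : ∀ x : M, TangentSpace (𝓡 d) x) : Prop :=
  ∀ (x : M) (v : TangentSpace (𝓡 d) x), S.metric.inner x (X x) v = S.potential x v

/-- An exact magnetic system on a closed manifold is Killing if the (unique) `g`-dual vector field
of `α` is a Killing vector field. -/
def IsKilling [CompactSpace M] : Prop :=
  ∃ X : ∀ x : M, TangentSpace (𝓡 d) x, S.IsDualField X ∧ IsKillingField S.metric X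

/-- The magnetic Lagrangian `L(q, v) = ½ |v|² - α_q(v)`. -/
def lagrangian (q : M) (v : TangentSpace (𝓡 d) q) : ℝ :=
  1 / 2 * S.metric.inner q v v - S.potential q v

/-- The action `S_{L+κ}(γ) = ∫₀ᵀ (L(γ, γ') + κ) dt`. -/
def action (κ T : ℝ) (γ : ℝ → M) : ℝ :=
  ∫ t in (0 : ℝ)..T, (S.lagrangian (γ t) (mfderiv 𝓘(ℝ, ℝ) (𝓡 d) γ t (1 : ℝ)) + κ)

/-- The Mañé critical value: the infimum of all `κ` such that `S_{L+κ}(γ) ≥ 0` for all `T > 0` and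
all smooth loops `γ : ℝ/Tℤ → M`, given as smooth `T`-periodic maps on `ℝ`. -/
def maneCriticalValue : ℝ :=
  sInf {κ : ℝ | ∀ T : ℝ, 0 < T → ∀ γ : ℝ → M, ContMDiff 𝓘(ℝ, ℝ) (𝓡 d) ∞ γ →
    Function.Periodic γ T → 0 ≤ S.action κ T γ}

/-- The dual norm `|α_q| = sup {|α_q(v)| : g_q(v, v) ≤ 1}` of `α` at `q`. -/
def potentialNormAt (q : M) : ℝ :=
  sSup {r : ℝ | ∃ v : TangentSpace (𝓡 d) q, S.metric.inner q v v ≤ 1 ∧ r = |S.potential q v|}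

/-- The norm `‖α‖_∞ = sup_q |α_q|`. -/
def potentialNorm : ℝ := ⨆ q : M, S.potentialNormAt q

end ExactMagneticSystem

/-! Restriction of ambient data to an immersed manifold. -/

section Induced

theorem isVonNBounded_of_pos (x : M) (g : TangentSpace (𝓡 d) x →L[ℝ] TangentSpace (𝓡 d) x →L[ℝ] ℝ) (hpos : ∀ v, v ≠ 0 → 0 < g v v) :
   Bornology.IsVonNBounded ℝ {v : TangentSpace (𝓡 d) x | g v v < 1} := by
  change Bornology.IsVonNBounded ℝ {v : EuclideanSpace ℝ (Fin d) | g v v < 1}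
  let h : EuclideanSpace ℝ (Fin d) →L[ℝ] EuclideanSpace ℝ (Fin d) →L[ℝ] ℝ := g
  have hh : ∀ v : EuclideanSpace ℝ (Fin d), v ≠ 0 → 0 < h v v := hpos
  change Bornology.IsVonNBounded ℝ {v : EuclideanSpace ℝ (Fin d) | h v v < 1}
  rw [NormedSpace.isVonNBounded_iff]
  obtain hE | hE := (Metric.sphere (0 : EuclideanSpace ℝ (Fin d)) 1).eq_empty_or_nonempty
  · refine (Metric.isBounded_closedBall (x := (0 : EuclideanSpace ℝ (Fin d))) (r := 0)).subset ?_
    intro v _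
    by_contra hv
    have hv0 : v ≠ 0 := fun h0 => hv (by simp [h0])
    have : (‖v‖⁻¹ • v) ∈ Metric.sphere (0 : EuclideanSpace ℝ (Fin d)) 1 := by
      simp [norm_smul, hv0]
    rw [hE] at this
    exact this
  · obtain ⟨u, hu, hmin⟩ := (isCompact_sphere (0 : EuclideanSpace ℝ (Fin d)) 1).exists_isMinOn hE
      (f := fun v => h v v) (h.continuous.clm_apply continuous_id).continuousOn
    have hu0 : u ≠ 0 := by
      rintro rfl
      simp at hu
    have hc := hh u hu0
    refine (Metric.isBounded_closedBall (x := (0 : EuclideanSpace ℝ (Fin d)))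
      (r := 1 + (h u u)⁻¹)).subset ?_
    intro v hv
    simp only [Set.mem_ofPred_eq] at hv
    rw [mem_closedBall_zero_iff]
    by_cases hv0 : v = 0
    · rw [hv0, norm_zero]; positivity
    have hn : 0 < ‖v‖ := norm_pos_iff.2 hv0
    have hs : (‖v‖⁻¹ • v) ∈ Metric.sphere (0 : EuclideanSpace ℝ (Fin d)) 1 := by
      simp [norm_smul, hv0]
    have h1 : h u u ≤ h (‖v‖⁻¹ • v) (‖v‖⁻¹ • v) := hmin hs
    simp only [map_smul, smul_apply, smul_eq_mul] at h1
    have h2 : h u u * (‖v‖ * ‖v‖) ≤ h v v := by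
      calc h u u * (‖v‖ * ‖v‖) ≤ (‖v‖⁻¹ * (‖v‖⁻¹ * h v v)) * (‖v‖ * ‖v‖) := by gcongr
        _ = h v v := by field_simp
    have h3 : ‖v‖ * ‖v‖ ≤ (h u u)⁻¹ := by
      rw [le_inv_comm₀ (by positivity) hc]
      rw [le_inv_comm₀ hc (by positivity), ← one_div, le_div_iff₀' hc]
      linarith
    nlinarith

variable [IsManifold (𝓡 d) ∞ M] {V : Type*} [NormedAddCommGroup V] [NormedSpace ℝ V]

theorem contMDiffAt_mvfderiv_inCoordinates {ι : M → V} (hι : ContMDiff (𝓡 d) 𝓘(ℝ, V) ∞ ι) (x₀ : M) :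
    ContMDiffAt (𝓡 d) 𝓘(ℝ, EuclideanSpace ℝ (Fin d) →L[ℝ] V) ∞ (fun x => (mvfderiv (𝓡 d) ι x) ∘L
      (trivializationAt (EuclideanSpace ℝ (Fin d)) (TangentSpace (𝓡 d) : M → Type _) x₀).symmL ℝ x) x₀ := by
  have h := ContMDiffAt.mfderiv_const (m := ∞) (hι x₀) (by rfl)
  convert! h using 1
  funext x
  refine ContinuousLinearMap.ext fun v => ?_
  simp only [inTangentCoordinates, ContinuousLinearMap.inCoordinates, mvfderiv]
  simp
  rfl

theorem contMDiff_inducedForm {ι : M → V} (hι : ContMDiff (𝓡 d) 𝓘(ℝ, V) ∞ ι)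
    {β : V → V →L[ℝ] ℝ} (hβ : ContDiff ℝ ∞ β) :
    ContMDiff (𝓡 d) ((𝓡 d).prod 𝓘(ℝ, EuclideanSpace ℝ (Fin d) →L[ℝ] ℝ)) ∞
      (fun x => TotalSpace.mk' (EuclideanSpace ℝ (Fin d) →L[ℝ] ℝ)
        (E := fun x : M => TangentSpace (𝓡 d) x →L[ℝ] ℝ) x
        ((β (ι x)) ∘L (mvfderiv (𝓡 d) ι x))) := by
  intro x₀
  rw [contMDiffAt_section]
  have h1 : ContMDiffAt (𝓡 d) 𝓘(ℝ, V →L[ℝ] ℝ) ∞ (fun x => β (ι x)) x₀ :=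
    (hβ.contMDiff.comp hι) x₀
  convert! h1.clm_comp (contMDiffAt_mvfderiv_inCoordinates hι x₀) using 1
  funext x
  refine ContinuousLinearMap.ext fun v => ?_
  simp [hom_trivializationAt_apply, ContinuousLinearMap.inCoordinates]

/-- The pullback `(v, w) ↦ B (D v) (D w)` of a bilinear form along a linear map on a tangent
space. -/
def pullbackForm {x : M} (B : V →L[ℝ] V →L[ℝ] ℝ) (D : TangentSpace (𝓡 d) x →L[ℝ] V) :
    TangentSpace (𝓡 d) x →L[ℝ] TangentSpace (𝓡 d) x →L[ℝ] ℝ :=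
  (ContinuousLinearMap.precomp ℝ D) ∘L B ∘L D

theorem contMDiff_inducedForm₂ {ι : M → V} (hι : ContMDiff (𝓡 d) 𝓘(ℝ, V) ∞ ι)
    (B : V →L[ℝ] V →L[ℝ] ℝ) :
    ContMDiff (𝓡 d) ((𝓡 d).prod 𝓘(ℝ, EuclideanSpace ℝ (Fin d) →L[ℝ] EuclideanSpace ℝ (Fin d) →L[ℝ] ℝ)) ∞
      (fun x => TotalSpace.mk' (EuclideanSpace ℝ (Fin d) →L[ℝ] EuclideanSpace ℝ (Fin d) →L[ℝ] ℝ)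
        (E := fun x : M => TangentSpace (𝓡 d) x →L[ℝ] TangentSpace (𝓡 d) x →L[ℝ] ℝ) x
        (pullbackForm B (mvfderiv (𝓡 d) ι x))) := by
  intro x₀
  rw [contMDiffAt_section]
  have h := contMDiffAt_mvfderiv_inCoordinates hι x₀
  have h2 : ContDiff ℝ ∞ (fun D : EuclideanSpace ℝ (Fin d) →L[ℝ] V => B.bilinearComp D D) := by
    have : (fun D : EuclideanSpace ℝ (Fin d) →L[ℝ] V => B.bilinearComp D D) =
      fun D => (((ContinuousLinearMap.compL ℝ (EuclideanSpace ℝ (Fin d)) V ℝ).flip D) ∘L (B ∘L D)) := by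
      funext D; ext v w; simp
    rw [this]
    fun_prop
  refine ((h2.contMDiff.contMDiffAt).comp x₀ h).congr_of_eventuallyEq ?_
  filter_upwards [(chartAt (EuclideanSpace ℝ (Fin d)) x₀).open_source.mem_nhds
    (mem_chart_source _ x₀)] with x hx
  refine ContinuousLinearMap.ext fun v => ContinuousLinearMap.ext fun w => ?_
  simp only [hom_trivializationAt_apply, ContinuousLinearMap.inCoordinates, pullbackForm]
  simp [Trivialization.linearMapAt_apply, hx, hom_trivializationAt_apply,
    ContinuousLinearMap.inCoordinates]

/-- The exact magnetic system on `M` induced by an immersion `ι : M → V` into a vector space from a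
positive definite symmetric bilinear form `B` on `V` and a smooth one-form `β` on `V`:
`g = ι^* B` and `α = ι^* β`. -/
def ExactMagneticSystem.induced (ι : M → V) (hι : ContMDiff (𝓡 d) 𝓘(ℝ, V) ∞ ι)
    (hinj : ∀ x, Function.Injective (mvfderiv (𝓡 d) ι x))
    (B : V →L[ℝ] V →L[ℝ] ℝ) (hsymm : ∀ v w, B v w = B w v) (hpos : ∀ v, v ≠ 0 → 0 < B v v)
    (β : V → V →L[ℝ] ℝ) (hβ : ContDiff ℝ ∞ β) : ExactMagneticSystem d M where
  metric :=
    { inner := fun x => pullbackForm B (mvfderiv (𝓡 d) ι x)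
      symm := fun _ _ _ => hsymm _ _
      pos := fun x _ hv => hpos _ fun h => hv (hinj x (h.trans (map_zero _).symm))
      isVonNBounded := fun x => isVonNBounded_of_pos x _
        fun _ hv => hpos _ fun h => hv (hinj x (h.trans (map_zero _).symm))
      contMDiff := contMDiff_inducedForm₂ hι B }
  potential x := (β (ι x)) ∘L (mvfderiv (𝓡 d) ι x)
  contMDiff_potential := contMDiff_inducedForm hι hβ

end Induced

end General

section Ellipsoid

variable {n : ℕ}

/-- The diagonal operator `z ↦ (c₁ z₁, …, cₙ zₙ)` on `ℂⁿ`. -/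
def diagOp (c : Fin n → ℝ) : EuclideanSpace ℂ (Fin n) →L[ℂ] EuclideanSpace ℂ (Fin n) :=
  Matrix.toEuclideanCLM (𝕜 := ℂ) (Matrix.diagonal fun i => (c i : ℂ))

theorem diagOp_apply (c : Fin n → ℝ) (z : EuclideanSpace ℂ (Fin n)) (i : Fin n) :
    diagOp c z i = c i * z i := by
  simp [diagOp, Matrix.mulVec_diagonal]

/-- The real bilinear form `(v, w) ↦ Re ⟨v, w⟩` on `ℂⁿ`, where `⟨·,·⟩` is the standard Hermitian
product (antilinear in the first argument). -/
def hermRe (n : ℕ) :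
    EuclideanSpace ℂ (Fin n) →L[ℝ] EuclideanSpace ℂ (Fin n) →L[ℝ] ℝ :=
  (LinearMap.toContinuousLinearMap.toLinearMap ∘ₗ
    LinearMap.mk₂ ℝ (fun v w : EuclideanSpace ℂ (Fin n) => (inner ℂ v w).re)
      (by intro u v w; simp)
      (by intro c v w; simp [inner_smul_left_eq_smul])
      (by intro u v w; simp)
      (by intro c v w; simp [inner_smul_right_eq_smul])).toContinuousLinearMap

/-- The real bilinear form `(v, w) ↦ Im ⟨v, w⟩` on `ℂⁿ`. -/
def hermIm (n : ℕ) :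
    EuclideanSpace ℂ (Fin n) →L[ℝ] EuclideanSpace ℂ (Fin n) →L[ℝ] ℝ :=
  (LinearMap.toContinuousLinearMap.toLinearMap ∘ₗ
    LinearMap.mk₂ ℝ (fun v w : EuclideanSpace ℂ (Fin n) => (inner ℂ v w).im)
      (by intro u v w; simp)
      (by intro c v w; simp [inner_smul_left_eq_smul])
      (by intro u v w; simp)
      (by intro c v w; simp [inner_smul_right_eq_smul])).toContinuousLinearMap

theorem hermRe_apply (v w : EuclideanSpace ℂ (Fin n)) : hermRe n v w = (inner ℂ v w).re := rfl

theorem hermIm_apply (v w : EuclideanSpace ℂ (Fin n)) : hermIm n v w = (inner ℂ v w).im := rfl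

/-- `(v, w) ↦ Re ⟨v, w⟩_A = Re ⟨A v, w⟩` for `A = diag(a₁, …, aₙ)`. -/
def weightedRe (a : Fin n → ℝ) :
    EuclideanSpace ℂ (Fin n) →L[ℝ] EuclideanSpace ℂ (Fin n) →L[ℝ] ℝ :=
  hermRe n ∘L (diagOp a).restrictScalars ℝ

/-- `(v, w) ↦ Im ⟨v, w⟩_A = Im ⟨A v, w⟩` for `A = diag(a₁, …, aₙ)`. -/
def weightedIm (a : Fin n → ℝ) :
    EuclideanSpace ℂ (Fin n) →L[ℝ] EuclideanSpace ℂ (Fin n) →L[ℝ] ℝ :=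
  hermIm n ∘L (diagOp a).restrictScalars ℝ

theorem weightedRe_apply (a : Fin n → ℝ) (v w : EuclideanSpace ℂ (Fin n)) :
    weightedRe a v w = ∑ i, a i * (inner ℂ (v i) (w i)).re := by
  change (inner ℂ (diagOp a v) w).re = _
  rw [PiLp.inner_apply, Complex.re_sum]
  refine Finset.sum_congr rfl fun i _ => ?_
  rw [diagOp_apply, ← Complex.real_smul, inner_smul_left_eq_smul, Complex.real_smul,
    Complex.re_ofReal_mul]

theorem hermRe_symm (v w : EuclideanSpace ℂ (Fin n)) : hermRe n v w = hermRe n w v := by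
  simp only [hermRe_apply]
  rw [← inner_conj_symm, Complex.conj_re]

theorem hermRe_pos (v : EuclideanSpace ℂ (Fin n)) (hv : v ≠ 0) : 0 < hermRe n v v := by
  rw [hermRe_apply]
  rw [show (inner ℂ v v).re = ‖v‖ ^ 2 from inner_self_eq_norm_sq (𝕜 := ℂ) v]
  positivity

theorem weightedRe_symm (a : Fin n → ℝ) (v w : EuclideanSpace ℂ (Fin n)) :
    weightedRe a v w = weightedRe a w v := by
  simp only [weightedRe_apply]
  refine Finset.sum_congr rfl fun i _ => ?_
  rw [← inner_conj_symm, Complex.conj_re]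

theorem weightedRe_pos (a : Fin n → ℝ) (ha : ∀ i, 0 < a i) (v : EuclideanSpace ℂ (Fin n))
    (hv : v ≠ 0) : 0 < weightedRe a v v := by
  rw [weightedRe_apply]
  have hnn : ∀ i, 0 ≤ (inner ℂ (v i) (v i)).re :=
    fun i => inner_self_nonneg (𝕜 := ℂ) (x := v i)
  obtain ⟨i, hi⟩ : ∃ i, v i ≠ 0 := by
    by_contra h
    push Not at h
    exact hv (by ext i; simpa using h i)
  refine Finset.sum_pos' (fun i _ => mul_nonneg (ha i).le (hnn i)) ⟨i, Finset.mem_univ i, ?_⟩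
  rw [show (inner ℂ (v i) (v i)).re = ‖v i‖ ^ 2 from inner_self_eq_norm_sq (𝕜 := ℂ) (v i)]
  exact mul_pos (ha i) (pow_pos (norm_pos_iff.2 hi) 2)

instance factFinrank [NeZero n] :
    Fact (finrank ℝ (EuclideanSpace ℂ (Fin n)) = (2 * n - 1) + 1) := ⟨by
  have := NeZero.ne n
  rw [← Module.finrank_mul_finrank ℝ ℂ (EuclideanSpace ℂ (Fin n))]
  simp
  omega⟩

/-- The unit sphere `S^{2n-1}` in `ℂⁿ`. -/
abbrev unitSphere (n : ℕ) : Set (EuclideanSpace ℂ (Fin n)) :=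
  Metric.sphere (0 : EuclideanSpace ℂ (Fin n)) 1

/-- The complex ellipsoid `E(A) = {z ∈ ℂⁿ : |z₁|²/a₁ + … + |zₙ|²/aₙ = 1}`. -/
def ellipsoid (a : Fin n → ℝ) (_ha : ∀ i, 0 < a i) : Set (EuclideanSpace ℂ (Fin n)) :=
  {z | ∑ i, ‖z i‖ ^ 2 / a i = 1}

/-- The homeomorphism `z ↦ √A z` from the unit sphere onto `E(A)`. -/
def ellipsoidHomeo (a : Fin n → ℝ) (ha : ∀ i, 0 < a i) : unitSphere n ≃ₜ ellipsoid a ha where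
  toFun z := ⟨diagOp (fun i => √(a i)) z, by
    have hz : ∑ i, ‖(z : EuclideanSpace ℂ (Fin n)) i‖ ^ 2 = 1 := by
      rw [← EuclideanSpace.norm_sq_eq, norm_eq_of_mem_sphere z, one_pow]
    change ∑ i, ‖diagOp (fun i => √(a i)) z i‖ ^ 2 / a i = 1
    rw [← hz]
    refine Finset.sum_congr rfl fun i _ => ?_
    have h := (ha i).ne'
    rw [diagOp_apply, norm_mul, mul_pow, Complex.norm_real, Real.norm_eq_abs, sq_abs,
      Real.sq_sqrt (ha i).le]
    field_simp⟩
  invFun z := ⟨diagOp (fun i => (√(a i))⁻¹) z, by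
    have hz : ∑ i, ‖(z : EuclideanSpace ℂ (Fin n)) i‖ ^ 2 / a i = 1 := z.2
    have : ‖diagOp (fun i => (√(a i))⁻¹) z‖ ^ 2 = 1 := by
      rw [EuclideanSpace.norm_sq_eq, ← hz]
      refine Finset.sum_congr rfl fun i _ => ?_
      have h := (ha i).ne'
      rw [diagOp_apply, norm_mul, mul_pow, Complex.norm_real, Real.norm_eq_abs, sq_abs,
        inv_pow, Real.sq_sqrt (ha i).le]
      field_simp
    rw [mem_sphere_zero_iff_norm]
    exact (pow_eq_one_iff_of_nonneg (norm_nonneg _) two_ne_zero).1 this⟩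
  left_inv z := by
    ext i
    have h : (√(a i) : ℂ) ≠ 0 := by simpa using (Real.sqrt_pos.2 (ha i)).ne'
    simp [diagOp_apply, h]
  right_inv z := by
    ext i
    have h : (√(a i) : ℂ) ≠ 0 := by simpa using (Real.sqrt_pos.2 (ha i)).ne'
    simp [diagOp_apply, h]
  continuous_toFun := by fun_prop
  continuous_invFun := by fun_prop

instance compactSpace_ellipsoid (a : Fin n → ℝ) (ha : ∀ i, 0 < a i) :
    CompactSpace (ellipsoid a ha) :=
  (ellipsoidHomeo a ha).compactSpace

variable [NeZero n]

/-- The smooth structure of `E(A)`, with charts the stereographic projections of the unit sphere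
composed with the inverse of `z ↦ √A z`. It is the embedded submanifold structure:
`E(A)` carries the subspace topology and the inclusion into `ℂⁿ` is a smooth immersion
(`contMDiff_coe_ellipsoid` and `injective_mvfderiv_coe_ellipsoid`). -/
instance chartedSpace_ellipsoid (a : Fin n → ℝ) (ha : ∀ i, 0 < a i) :
    ChartedSpace (EuclideanSpace ℝ (Fin (2 * n - 1))) (ellipsoid a ha) where
  atlas := {e | ∃ e' ∈ atlas (EuclideanSpace ℝ (Fin (2 * n - 1))) (unitSphere n),
    e = (ellipsoidHomeo a ha).symm.toOpenPartialHomeomorph.trans e'}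
  chartAt z := (ellipsoidHomeo a ha).symm.toOpenPartialHomeomorph.trans
    (chartAt (EuclideanSpace ℝ (Fin (2 * n - 1))) ((ellipsoidHomeo a ha).symm z))
  mem_chart_source z := by simp
  chart_mem_atlas z := ⟨_, chart_mem_atlas _ _, rfl⟩

theorem chartAt_ellipsoid (a : Fin n → ℝ) (ha : ∀ i, 0 < a i) (z : ellipsoid a ha) :
    chartAt (EuclideanSpace ℝ (Fin (2 * n - 1))) z =
      (ellipsoidHomeo a ha).symm.toOpenPartialHomeomorph.trans
        (chartAt (EuclideanSpace ℝ (Fin (2 * n - 1))) ((ellipsoidHomeo a ha).symm z)) := rfl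

instance isManifold_ellipsoid (a : Fin n → ℝ) (ha : ∀ i, 0 < a i) :
    IsManifold (𝓡 (2 * n - 1)) ∞ (ellipsoid a ha) where
  compatible := by
    rintro _ _ ⟨e₁, h₁, rfl⟩ ⟨e₂, h₂, rfl⟩
    have h := HasGroupoid.compatible (G := contDiffGroupoid ∞ (𝓡 (2 * n - 1))) h₁ h₂
    convert! h using 1
    rw [OpenPartialHomeomorph.trans_symm_eq_symm_trans_symm, OpenPartialHomeomorph.trans_assoc,
      ← OpenPartialHomeomorph.trans_assoc _ _ e₂, ← Homeomorph.symm_toOpenPartialHomeomorph, ← Homeomorph.trans_toOpenPartialHomeomorph]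
    simp

/-- The diffeomorphism `z ↦ √A z` from the unit sphere onto `E(A)`. -/
def ellipsoidDiffeo (a : Fin n → ℝ) (ha : ∀ i, 0 < a i) :
    Diffeomorph (𝓡 (2 * n - 1)) (𝓡 (2 * n - 1)) (unitSphere n) (ellipsoid a ha) ∞ where
  toEquiv := (ellipsoidHomeo a ha).toEquiv
  contMDiff_toFun := by
    intro x
    rw [contMDiffAt_iff]
    refine ⟨(ellipsoidHomeo a ha).continuous.continuousAt, ?_⟩
    refine contDiffWithinAt_id.congr_of_eventuallyEq_of_mem ?_ (by simp)
    filter_upwards [mem_nhdsWithin_of_mem_nhds (extChartAt_target_mem_nhds (I := 𝓡 (2 * n - 1)) x)]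
      with y hy
    have h := (extChartAt (𝓡 (2 * n - 1)) x).right_inv hy
    simpa [extChartAt, chartAt_ellipsoid] using h
  contMDiff_invFun := by
    intro x
    rw [contMDiffAt_iff]
    refine ⟨(ellipsoidHomeo a ha).symm.continuous.continuousAt, ?_⟩
    refine contDiffWithinAt_id.congr_of_eventuallyEq_of_mem ?_ (by simp)
    filter_upwards [mem_nhdsWithin_of_mem_nhds (extChartAt_target_mem_nhds (I := 𝓡 (2 * n - 1)) x)]
      with y hy
    have h := (extChartAt (𝓡 (2 * n - 1)) x).right_inv hy
    simpa [extChartAt, chartAt_ellipsoid] using h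

theorem contMDiff_coe_ellipsoid (a : Fin n → ℝ) (ha : ∀ i, 0 < a i) :
    ContMDiff (𝓡 (2 * n - 1)) 𝓘(ℝ, EuclideanSpace ℂ (Fin n)) ∞
      ((↑) : ellipsoid a ha → EuclideanSpace ℂ (Fin n)) := by
  have h : ((↑) : ellipsoid a ha → EuclideanSpace ℂ (Fin n)) =
      ((diagOp fun i => √(a i)).restrictScalars ℝ) ∘
        ((↑) : unitSphere n → EuclideanSpace ℂ (Fin n)) ∘ (ellipsoidDiffeo a ha).symm := by
    funext z
    exact congrArg Subtype.val ((ellipsoidDiffeo a ha).apply_symm_apply z).symm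
  rw [h]
  exact (ContinuousLinearMap.contMDiff _).comp
    (contMDiff_coe_sphere.comp (ellipsoidDiffeo a ha).symm.contMDiff)

theorem injective_mvfderiv_coe_ellipsoid (a : Fin n → ℝ) (ha : ∀ i, 0 < a i)
    (x : ellipsoid a ha) : Function.Injective
      (mvfderiv (𝓡 (2 * n - 1)) ((↑) : ellipsoid a ha → EuclideanSpace ℂ (Fin n)) x) := by
  set S : unitSphere n → EuclideanSpace ℂ (Fin n) := (↑)
  set ι : ellipsoid a ha → EuclideanSpace ℂ (Fin n) := (↑)
  have hS : ContMDiff (𝓡 (2 * n - 1)) 𝓘(ℝ, EuclideanSpace ℂ (Fin n)) ∞ S := contMDiff_coe_sphere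
  have hι : ContMDiff (𝓡 (2 * n - 1)) 𝓘(ℝ, EuclideanSpace ℂ (Fin n)) ∞ ι :=
    contMDiff_coe_ellipsoid a ha
  set F := ellipsoidDiffeo a ha
  let T : EuclideanSpace ℂ (Fin n) →L[ℝ] EuclideanSpace ℂ (Fin n) :=
    (diagOp fun i => (√(a i))⁻¹).restrictScalars ℝ
  have hT : ContMDiff 𝓘(ℝ, EuclideanSpace ℂ (Fin n)) 𝓘(ℝ, EuclideanSpace ℂ (Fin n)) ∞ T :=
    ContinuousLinearMap.contMDiff _
  have h1 : S ∘ F.symm = T ∘ ι := rfl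
  have hd : mfderiv (𝓡 (2 * n - 1)) 𝓘(ℝ, EuclideanSpace ℂ (Fin n)) (S ∘ F.symm) x =
      mfderiv (𝓡 (2 * n - 1)) 𝓘(ℝ, EuclideanSpace ℂ (Fin n)) (T ∘ ι) x := by rw [h1]
  rw [mfderiv_comp x (hS.mdifferentiable (by simp) _) (F.symm.contMDiff.mdifferentiable (by simp) _),
    mfderiv_comp x (hT.mdifferentiable (by simp) _) (hι.mdifferentiable (by simp) _)] at hd
  have hF : Function.Injective (mfderiv (𝓡 (2 * n - 1)) (𝓡 (2 * n - 1)) F.symm x) :=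
    (F.symm.mfderivToContinuousLinearEquiv (by simp) x).injective
  intro v w hvw
  refine hF (injective_mvfderiv_subtypeVal_sphere (F.symm x) ?_)
  have hv := DFunLike.congr_fun hd v
  have hw := DFunLike.congr_fun hd w
  change mfderiv (𝓡 (2 * n - 1)) 𝓘(ℝ, EuclideanSpace ℂ (Fin n)) S (F.symm x) _ =
    mfderiv (𝓡 (2 * n - 1)) 𝓘(ℝ, EuclideanSpace ℂ (Fin n)) S (F.symm x) _
  refine hv.trans (Eq.trans ?_ hw.symm)
  exact congrArg (mfderiv 𝓘(ℝ, EuclideanSpace ℂ (Fin n)) 𝓘(ℝ, EuclideanSpace ℂ (Fin n)) T (ι x)) hvw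

/-- The system `(S^{2n-1}, g_A, dα_A)`: restriction of `Re ⟨·,·⟩_A` and `½ Im ⟨z, ·⟩_A` to the unit
sphere. -/
def sphereSystem (a : Fin n → ℝ) (ha : ∀ i, 0 < a i) :
    ExactMagneticSystem (2 * n - 1) (unitSphere n) :=
  ExactMagneticSystem.induced ((↑) : unitSphere n → EuclideanSpace ℂ (Fin n))
    contMDiff_coe_sphere injective_mvfderiv_subtypeVal_sphere
    (weightedRe a) (weightedRe_symm a) (weightedRe_pos a ha)
    (fun z => (1 / 2 : ℝ) • weightedIm a z) ((weightedIm a).contDiff.const_smul _)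

/-- The system `(E(A), g, dα)`: restriction of `Re ⟨·,·⟩` and `½ Im ⟨z, ·⟩` to the ellipsoid. -/
def ellipsoidSystem (a : Fin n → ℝ) (ha : ∀ i, 0 < a i) :
    ExactMagneticSystem (2 * n - 1) (ellipsoid a ha) :=
  ExactMagneticSystem.induced ((↑) : ellipsoid a ha → EuclideanSpace ℂ (Fin n))
    (contMDiff_coe_ellipsoid a ha) (injective_mvfderiv_coe_ellipsoid a ha)
    (hermRe n) hermRe_symm hermRe_pos
    (fun z => (1 / 2 : ℝ) • hermIm n z) ((hermIm n).contDiff.const_smul _)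

theorem sphereSystem_metric (a : Fin n → ℝ) (ha : ∀ i, 0 < a i) (z : unitSphere n)
    (v w : TangentSpace (𝓡 (2 * n - 1)) z) :
    (sphereSystem a ha).metric.inner z v w =
      (inner ℂ (diagOp a (mvfderiv (𝓡 (2 * n - 1)) Subtype.val z v))
        (mvfderiv (𝓡 (2 * n - 1)) Subtype.val z w)).re := rfl

theorem sphereSystem_potential (a : Fin n → ℝ) (ha : ∀ i, 0 < a i) (z : unitSphere n)
    (v : TangentSpace (𝓡 (2 * n - 1)) z) :
    (sphereSystem a ha).potential z v =
      1 / 2 * (inner ℂ (diagOp a z) (mvfderiv (𝓡 (2 * n - 1)) Subtype.val z v)).im := rfl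

theorem ellipsoidSystem_metric (a : Fin n → ℝ) (ha : ∀ i, 0 < a i) (z : ellipsoid a ha)
    (v w : TangentSpace (𝓡 (2 * n - 1)) z) :
    (ellipsoidSystem a ha).metric.inner z v w =
      (inner ℂ (mvfderiv (𝓡 (2 * n - 1)) Subtype.val z v)
        (mvfderiv (𝓡 (2 * n - 1)) Subtype.val z w)).re := rfl

theorem ellipsoidSystem_potential (a : Fin n → ℝ) (ha : ∀ i, 0 < a i) (z : ellipsoid a ha)
    (v : TangentSpace (𝓡 (2 * n - 1)) z) :
    (ellipsoidSystem a ha).potential z v =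
      1 / 2 * (inner ℂ (z : EuclideanSpace ℂ (Fin n))
        (mvfderiv (𝓡 (2 * n - 1)) Subtype.val z v)).im := rfl

end Ellipsoid

end

end Magnetic

/-! In both systems the dual field is the restriction of X(z) = (i/2)z. Antilinearity in the first
slot gives Re⟨(i/2)z, w⟩ = ½ Im⟨z, w⟩, and A is complex linear, so the same identity holds for
⟨·,·⟩_A. The field generates the scalar rotation z ↦ e^{it/2}z, which is unitary and commutes with A
and √A. It therefore preserves the sphere, the ellipsoid and both metrics, and both systems are
Killing.

For the Mañé value, complete the square: L(q, v) = ½|v − X|² − ½|X|². If |X|² ≤ 2c everywhere, then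
L + κ ≥ 0 pointwise for κ ≥ c. Conversely, on a closed orbit of X where |X|² = 2c the square
vanishes and the action over time T is T(κ − c), which forces κ ≥ c. This is
`maneCriticalValue_eq_of_isDualField`. By Cauchy–Schwarz the dual norm of α at q is |X_q|
(`potentialNormAt_eq_of_isDualField`).

On the ellipsoid |X_z|² = |z|²/4, and |z|² has maximum a_n, attained at √a_n e_n. The orbit through
this point is closed, because e^{it/2} has period 4π, and |z| is constant along it. Hence c = a_n/8
and ‖α‖_∞² = a_n/4. -/

namespace Magnetic

/-! ### Curves and flows seen through an immersion -/

section General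

variable {d : ℕ} {M : Type*} [TopologicalSpace M] [ChartedSpace (EuclideanSpace ℝ (Fin d)) M]

/-- Chain rule. Where dι is injective, it reduces identities between intrinsic velocities to
derivatives in V. -/
theorem mvfderiv_mfderiv_curve {V : Type*} [NormedAddCommGroup V] [NormedSpace ℝ V]
    {ι : M → V} (hι : ContMDiff (𝓡 d) 𝓘(ℝ, V) ∞ ι) {γ : ℝ → M} {t : ℝ}
    (hγ : MDifferentiableAt 𝓘(ℝ, ℝ) (𝓡 d) γ t) {w : V} (hw : HasDerivAt (fun s => ι (γ s)) w t) :
    mvfderiv (𝓡 d) ι (γ t) (mfderiv 𝓘(ℝ, ℝ) (𝓡 d) γ t (1 : ℝ)) = w := by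
  have h1 : HasMFDerivAt 𝓘(ℝ, ℝ) 𝓘(ℝ, V) (ι ∘ γ) t
      ((mfderiv (𝓡 d) 𝓘(ℝ, V) ι (γ t)).comp (mfderiv 𝓘(ℝ, ℝ) (𝓡 d) γ t)) :=
    ((hι.mdifferentiable (by simp)) (γ t)).hasMFDerivAt.comp t hγ.hasMFDerivAt
  have h2 := hw.hasFDerivAt.hasMFDerivAt
  have h3 := DFunLike.congr_fun (hasMFDerivAt_unique h1 h2) (1 : ℝ)
  refine h3.trans ?_
  exact one_smul ℝ w

/-- The velocity field at time zero of a one-parameter family of maps. -/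
noncomputable def velocityField (Φ : ℝ → M → M) (hΦ₀ : ∀ x, Φ 0 x = x) (x : M) :
    TangentSpace (𝓡 d) x :=
  hΦ₀ x ▸ (mfderiv 𝓘(ℝ, ℝ) (𝓡 d) (fun t => Φ t x) 0 (1 : ℝ) : TangentSpace (𝓡 d) (Φ 0 x))

theorem mvfderiv_velocityField {V : Type*} [NormedAddCommGroup V] [NormedSpace ℝ V] {ι : M → V}
    (hι : ContMDiff (𝓡 d) 𝓘(ℝ, V) ∞ ι) {Φ : ℝ → M → M}
    (hΦ₀ : ∀ x, Φ 0 x = x) (hΦs : ∀ x, ContMDiff 𝓘(ℝ, ℝ) (𝓡 d) ∞ fun t => Φ t x)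
    {J : V → V} (hΦι : ∀ x t, HasDerivAt (fun s => ι (Φ s x)) (J (ι (Φ t x))) t) (x : M) :
    mvfderiv (𝓡 d) ι x (velocityField Φ hΦ₀ x) = J (ι x) := by
  have h := mvfderiv_mfderiv_curve hι ((hΦs x).mdifferentiable (by simp) 0) (hΦι x 0)
  -- The transport along Φ 0 x = x becomes invisible after dι, because V does not depend on the base
  -- point.
  have key : ∀ (y z : M) (e : y = z) (v : TangentSpace (𝓡 d) y),
      mvfderiv (𝓡 d) ι z (e ▸ v : TangentSpace (𝓡 d) z) = mvfderiv (𝓡 d) ι y v := by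
    rintro y _ rfl v
    rfl
  rw [velocityField, key]
  refine h.trans ?_
  rw [hΦ₀]

/-- In V every orbit solves the autonomous equation u' = J u, so its velocity depends only on the
point reached. Injectivity of dι brings this back to M, and no group law for Φ is needed. -/
theorem mfderiv_orbit_eq_velocityField {V : Type*} [NormedAddCommGroup V]
    [NormedSpace ℝ V] {ι : M → V} (hι : ContMDiff (𝓡 d) 𝓘(ℝ, V) ∞ ι)
    (hinj : ∀ x, Function.Injective (mvfderiv (𝓡 d) ι x)) {Φ : ℝ → M → M}
    (hΦ₀ : ∀ x, Φ 0 x = x) (hΦs : ∀ x, ContMDiff 𝓘(ℝ, ℝ) (𝓡 d) ∞ fun t => Φ t x)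
    {J : V → V} (hΦι : ∀ x t, HasDerivAt (fun s => ι (Φ s x)) (J (ι (Φ t x))) t) (x : M) (t : ℝ) :
    mfderiv 𝓘(ℝ, ℝ) (𝓡 d) (fun s => Φ s x) t (1 : ℝ) = velocityField Φ hΦ₀ (Φ t x) :=
  hinj _ <| (mvfderiv_mfderiv_curve hι ((hΦs x).mdifferentiable (by simp) t) (hΦι x t)).trans
    (mvfderiv_velocityField hι hΦ₀ hΦs hΦι _).symm

variable [IsManifold (𝓡 d) ∞ M]

/-! ### Mañé value and dual norm from the dual field -/

namespace ExactMagneticSystem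

variable (S : ExactMagneticSystem d M)

theorem metric_self_nonneg (q : M) (v : TangentSpace (𝓡 d) q) : 0 ≤ S.metric.inner q v v := by
  by_cases hv : v = 0
  · simp [hv]
  · exact (S.metric.pos q v hv).le

/-- Completing the square with α(v) = g(X, v). Over each point L is minimal exactly at v = X. -/
theorem lagrangian_eq_of_isDualField {X : ∀ x : M, TangentSpace (𝓡 d) x} (hX : S.IsDualField X)
    (q : M) (v : TangentSpace (𝓡 d) q) :
    S.lagrangian q v = 1 / 2 * S.metric.inner q (v - X q) (v - X q)
      - 1 / 2 * S.metric.inner q (X q) (X q) := by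
  have h1 := hX q v
  have h2 := S.metric.symm q v (X q)
  simp only [lagrangian, map_sub, sub_apply]
  linarith

/-- If the dual field `X` satisfies `|X|² ≤ 2c` and `|X|² = 2c` along a closed orbit, then the Mañé
critical value is `c`. -/
theorem maneCriticalValue_eq_of_isDualField {X : ∀ x : M, TangentSpace (𝓡 d) x}
    (hX : S.IsDualField X) {c : ℝ} (hle : ∀ q, S.metric.inner q (X q) (X q) ≤ 2 * c)
    {γ : ℝ → M} (hγ : ContMDiff 𝓘(ℝ, ℝ) (𝓡 d) ∞ γ) {T : ℝ} (hT : 0 < T)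
    (hper : Function.Periodic γ T)
    (hγX : ∀ t, mfderiv 𝓘(ℝ, ℝ) (𝓡 d) γ t (1 : ℝ) = X (γ t))
    (hc : ∀ t, S.metric.inner (γ t) (X (γ t)) (X (γ t)) = 2 * c) :
    S.maneCriticalValue = c := by
  have hset : {κ : ℝ | ∀ T : ℝ, 0 < T → ∀ γ : ℝ → M, ContMDiff 𝓘(ℝ, ℝ) (𝓡 d) ∞ γ →
      Function.Periodic γ T → 0 ≤ S.action κ T γ} = Set.Ici c := by
    ext κ
    refine ⟨fun h => ?_, fun h T hT γ _ _ => ?_⟩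
    · have h0 := h T hT γ hγ hper
      -- Along the given orbit v = X, so the square vanishes and the Lagrangian is the constant −c.
      have : S.action κ T γ = T * (κ - c) := by
        rw [action, intervalIntegral.integral_congr (g := fun _ => κ - c)]
        · simp [mul_sub]
        · intro t _
          change S.lagrangian (γ t) (mfderiv 𝓘(ℝ, ℝ) (𝓡 d) γ t (1 : ℝ)) + κ = κ - c
          rw [hγX, S.lagrangian_eq_of_isDualField hX, hc, sub_self, map_zero]
          ring
      rw [this] at h0
      exact sub_nonneg.1 (nonneg_of_mul_nonneg_right h0 hT)
    -- Here the integrand is already nonnegative at each time, so neither periodicity nor smoothness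
    -- of the loop plays a role.
    · refine intervalIntegral.integral_nonneg hT.le fun t _ => ?_
      rw [S.lagrangian_eq_of_isDualField hX]
      have h1 := S.metric_self_nonneg (γ t)
        (mfderiv 𝓘(ℝ, ℝ) (𝓡 d) γ t (1 : ℝ) - X (γ t))
      have h2 := hle (γ t)
      have h3 : c ≤ κ := h
      linarith
  rw [maneCriticalValue, hset, csInf_Ici]

/-- Cauchy–Schwarz for g, obtained from |X − s v|² ≥ 0 and |v| ≤ 1. -/
theorem abs_potential_le {X : ∀ x : M, TangentSpace (𝓡 d) x} (hX : S.IsDualField X) (q : M)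
    {v : TangentSpace (𝓡 d) q} (hv : S.metric.inner q v v ≤ 1) :
    |S.potential q v| ≤ √(S.metric.inner q (X q) (X q)) := by
  set N := S.metric.inner q (X q) (X q)
  have hN : 0 ≤ N := S.metric_self_nonneg q _
  rw [← hX q v]
  set p := S.metric.inner q (X q) v
  have key : ∀ s : ℝ, 0 ≤ N - 2 * s * p + s ^ 2 := fun s => by
    have h := S.metric_self_nonneg q (X q - s • v)
    have h2 : S.metric.inner q v (X q) = p := S.metric.symm q v (X q)
    simp only [map_sub, map_smul, sub_apply, smul_apply, smul_eq_mul, h2] at h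
    change 0 ≤ N - s * p - s * (p - s * S.metric.inner q v v) at h
    nlinarith [sq_nonneg s]
  apply Real.abs_le_sqrt
  -- The choice s = p minimises the quadratic and gives p² ≤ N.
  nlinarith [key p]

theorem potentialNormAt_eq_of_isDualField {X : ∀ x : M, TangentSpace (𝓡 d) x}
    (hX : S.IsDualField X) (q : M) :
    S.potentialNormAt q = √(S.metric.inner q (X q) (X q)) := by
  -- The supremum is attained at X/|X|. If |X| = 0, the convention 0⁻¹ = 0 makes the witness the
  -- zero vector, so no case split is needed.
  refine IsGreatest.csSup_eq ⟨⟨(√(S.metric.inner q (X q) (X q)))⁻¹ • X q, ?_, ?_⟩, ?_⟩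
  · simp only [map_smul, smul_apply, smul_eq_mul]
    set N := S.metric.inner q (X q) (X q)
    have hN : 0 ≤ N := S.metric_self_nonneg q _
    rw [← mul_assoc, ← mul_inv, Real.mul_self_sqrt hN]
    exact inv_mul_le_one
  · rw [map_smul, ← hX q (X q), smul_eq_mul]
    set N := S.metric.inner q (X q) (X q)
    have hN : 0 ≤ N := S.metric_self_nonneg q _
    rw [mul_comm, ← div_eq_mul_inv, Real.div_sqrt, abs_of_nonneg (Real.sqrt_nonneg _)]
  · rintro r ⟨v, hv, rfl⟩
    exact S.abs_potential_le hX q hv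

theorem potentialNorm_eq_of_isDualField {X : ∀ x : M, TangentSpace (𝓡 d) x}
    (hX : S.IsDualField X) {c : ℝ} (hle : ∀ q, S.metric.inner q (X q) (X q) ≤ c)
    {q₀ : M} (hq₀ : S.metric.inner q₀ (X q₀) (X q₀) = c) : S.potentialNorm = √c := by
  refine IsGreatest.csSup_eq ⟨⟨q₀, ?_⟩, ?_⟩
  · change S.potentialNormAt q₀ = _
    rw [S.potentialNormAt_eq_of_isDualField hX, hq₀]
  · rintro _ ⟨q, rfl⟩
    change S.potentialNormAt q ≤ _
    rw [S.potentialNormAt_eq_of_isDualField hX]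
    exact Real.sqrt_le_sqrt (hle q)

end ExactMagneticSystem

/-! ### Dual and Killing fields of induced systems -/

section Immersion

variable {V : Type*} [NormedAddCommGroup V] [NormedSpace ℝ V] {ι : M → V}

variable (hι : ContMDiff (𝓡 d) 𝓘(ℝ, V) ∞ ι)
    (hinj : ∀ x, Function.Injective (mvfderiv (𝓡 d) ι x))
    (B : V →L[ℝ] V →L[ℝ] ℝ) (hsymm : ∀ v w, B v w = B w v) (hpos : ∀ v, v ≠ 0 → 0 < B v v)
    (β : V → V →L[ℝ] ℝ) (hβ : ContDiff ℝ ∞ β)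

/-- Duality can be tested in V: restricting B(J v, ·) = β v to tangent vectors gives g(X, ·) = α. -/
theorem isDualField_induced {X : ∀ x : M, TangentSpace (𝓡 d) x} {J : V → V}
    (hX : ∀ x, mvfderiv (𝓡 d) ι x (X x) = J (ι x)) (hJ : ∀ v w, B (J v) w = β v w) :
    (ExactMagneticSystem.induced ι hι hinj B hsymm hpos β hβ).IsDualField X := fun x v => by
  change B (mvfderiv (𝓡 d) ι x (X x)) (mvfderiv (𝓡 d) ι x v) = β (ι x) (mvfderiv (𝓡 d) ι x v)
  rw [hX, hJ]

/-- A flow on `M` intertwined by the immersion `ι` with linear `B`-isometries of the ambient space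
generates a Killing field. -/
theorem isKillingField_induced (Φ : ℝ → Diffeomorph (𝓡 d) (𝓡 d) M M ∞)
    (hΦ₀ : ∀ x, Φ 0 x = x) (hΦs : ∀ x, ContMDiff 𝓘(ℝ, ℝ) (𝓡 d) ∞ fun t => Φ t x)
    {ρ : ℝ → V →L[ℝ] V} (hρ : ∀ t x, ι (Φ t x) = ρ t (ι x))
    (hρB : ∀ t v w, B (ρ t v) (ρ t w) = B v w)
    {J : V → V} (hΦι : ∀ x t, HasDerivAt (fun s => ι (Φ s x)) (J (ι (Φ t x))) t) :
    IsKillingField (ExactMagneticSystem.induced ι hι hinj B hsymm hpos β hβ).metric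
      (velocityField (fun t => Φ t) hΦ₀) := by
  refine ⟨Φ, hΦ₀, fun x t => ?_, fun t x v w => ?_⟩
  · have h := ((hΦs x).mdifferentiable (by simp) t).hasMFDerivAt
    -- The integral curve condition compares linear maps out of ℝ, which are determined by their
    -- value at 1. The tangent spaces unfold to the model space used here.
    have hX : ∀ L L' : ℝ →L[ℝ] EuclideanSpace ℝ (Fin d), L 1 = L' 1 → L = L' :=
      fun _ _ => ContinuousLinearMap.ext_ring
    refine h.congr_mfderiv (hX _ _ ?_)
    refine (mfderiv_orbit_eq_velocityField (Φ := fun t => Φ t) hι hinj hΦ₀ hΦs hΦι x t).trans ?_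
    exact (one_smul ℝ (velocityField (fun t => Φ t) hΦ₀ (Φ t x))).symm
  -- Differentiating ι ∘ Φ_t = ρ_t ∘ ι, where ρ_t is linear and so is its own derivative, turns dΦ_t
  -- into the B-isometry ρ_t.
  · have hd : ∀ u : TangentSpace (𝓡 d) x,
        mvfderiv (𝓡 d) ι (Φ t x) (mfderiv (𝓡 d) (𝓡 d) (Φ t) x u) = ρ t (mvfderiv (𝓡 d) ι x u) := by
      intro u
      have h1 : HasMFDerivAt (𝓡 d) 𝓘(ℝ, V) (ι ∘ Φ t) x _ :=
        ((hι.mdifferentiable (by simp)) (Φ t x)).hasMFDerivAt.comp x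
          ((Φ t).contMDiff.mdifferentiable (by simp) x).hasMFDerivAt
      have h2 : HasMFDerivAt (𝓡 d) 𝓘(ℝ, V) (ρ t ∘ ι) x _ :=
        (ρ t).hasFDerivAt.hasMFDerivAt.comp x
          ((hι.mdifferentiable (by simp)) x).hasMFDerivAt
      rw [← show ι ∘ Φ t = ρ t ∘ ι from funext (hρ t)] at h2
      exact DFunLike.congr_fun (hasMFDerivAt_unique h1 h2) u
    change B (mvfderiv (𝓡 d) ι (Φ t x) _) (mvfderiv (𝓡 d) ι (Φ t x) _) =
      B (mvfderiv (𝓡 d) ι x v) (mvfderiv (𝓡 d) ι x w)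
    rw [hd, hd, hρB]

end Immersion

end General

/-! ### Scalar rotation of ℂⁿ and its Hermitian identities -/

section Ellipsoid

variable {n : ℕ}

open Complex in
/-- The scalar rotation `z ↦ e^{it/2} z` of `ℂⁿ`. -/
noncomputable def halfRotation (n : ℕ) (t : ℝ) :
    EuclideanSpace ℂ (Fin n) →L[ℝ] EuclideanSpace ℂ (Fin n) :=
  ((exp (t / 2 * I)) • ContinuousLinearMap.id ℂ (EuclideanSpace ℂ (Fin n))).restrictScalars ℝ

theorem halfRotation_apply (t : ℝ) (z : EuclideanSpace ℂ (Fin n)) :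
    halfRotation n t z = Complex.exp (t / 2 * Complex.I) • z := rfl

theorem norm_exp_half_mul_I (t : ℝ) : ‖Complex.exp (t / 2 * Complex.I)‖ = 1 := by
  simpa using Complex.norm_exp_ofReal_mul_I (t / 2)

theorem halfRotation_zero (z : EuclideanSpace ℂ (Fin n)) : halfRotation n 0 z = z := by
  simp [halfRotation_apply]

theorem halfRotation_add (s t : ℝ) (z : EuclideanSpace ℂ (Fin n)) :
    halfRotation n (s + t) z = halfRotation n s (halfRotation n t z) := by
  simp only [halfRotation_apply, smul_smul, ← Complex.exp_add]
  congr 2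
  push_cast
  ring

theorem norm_halfRotation (t : ℝ) (z : EuclideanSpace ℂ (Fin n)) : ‖halfRotation n t z‖ = ‖z‖ := by
  rw [halfRotation_apply, norm_smul, norm_exp_half_mul_I, one_mul]

/-- The factor ½ in α makes the rotation run at half speed, so orbits close up after 4π rather than
2π. -/
theorem halfRotation_four_pi (z : EuclideanSpace ℂ (Fin n)) :
    halfRotation n (4 * Real.pi) z = z := by
  rw [halfRotation_apply, show ((4 * Real.pi : ℝ) : ℂ) / 2 * Complex.I
    = 2 * Real.pi * Complex.I by push_cast; ring, Complex.exp_two_pi_mul_I, one_smul]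

theorem contDiff_halfRotation (z : EuclideanSpace ℂ (Fin n)) :
    ContDiff ℝ ∞ fun t => halfRotation n t z := by
  have h : ContDiff ℝ ∞ fun t : ℝ => Complex.exp (t / 2 * Complex.I) :=
    ((Complex.ofRealCLM.contDiff.div_const 2).mul contDiff_const).cexp
  exact h.smul contDiff_const

theorem hasDerivAt_halfRotation (z : EuclideanSpace ℂ (Fin n)) (t : ℝ) :
    HasDerivAt (fun s => halfRotation n s z) ((Complex.I / 2) • halfRotation n t z) t := by
  have h : HasDerivAt (fun s : ℝ => Complex.exp (s / 2 * Complex.I))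
      (Complex.exp (t / 2 * Complex.I) * (1 / 2 * Complex.I)) t :=
    (((hasDerivAt_id t).ofReal_comp.div_const 2).mul_const Complex.I).cexp
  convert! h.smul_const z using 1
  rw [halfRotation_apply, smul_smul]
  congr 1
  ring

theorem hermRe_halfRotation (t : ℝ) (v w : EuclideanSpace ℂ (Fin n)) :
    hermRe n (halfRotation n t v) (halfRotation n t w) = hermRe n v w := by
  rw [hermRe_apply, hermRe_apply, halfRotation_apply, halfRotation_apply, inner_smul_left,
    inner_smul_right, ← mul_assoc, Complex.conj_mul', norm_exp_half_mul_I]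
  simp

theorem diagOp_halfRotation (c : Fin n → ℝ) (t : ℝ) (z : EuclideanSpace ℂ (Fin n)) :
    diagOp c (halfRotation n t z) = halfRotation n t (diagOp c z) := by
  simp only [halfRotation_apply, map_smul]

theorem weightedRe_halfRotation (a : Fin n → ℝ) (t : ℝ) (v w : EuclideanSpace ℂ (Fin n)) :
    weightedRe a (halfRotation n t v) (halfRotation n t w) = weightedRe a v w := by
  change hermRe n (diagOp a (halfRotation n t v)) _ = hermRe n (diagOp a v) w
  rw [diagOp_halfRotation, hermRe_halfRotation]

/-- Conjugation in the first slot turns i/2 into −i/2, and Re(−(i/2)ζ) = ½ Im ζ. This identifies the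
dual field. -/
theorem hermRe_I_div_two_smul (v w : EuclideanSpace ℂ (Fin n)) :
    hermRe n ((Complex.I / 2) • v) w = ((1 / 2 : ℝ) • hermIm n v) w := by
  rw [hermRe_apply, smul_apply, hermIm_apply, inner_smul_left]
  simp [Complex.div_re, Complex.div_im]
  ring

/-- A commutes with multiplication by i/2, so the unweighted identity applies to Av. -/
theorem weightedRe_I_div_two_smul (a : Fin n → ℝ) (v w : EuclideanSpace ℂ (Fin n)) :
    weightedRe a ((Complex.I / 2) • v) w = ((1 / 2 : ℝ) • weightedIm a v) w := by
  change hermRe n (diagOp a ((Complex.I / 2) • v)) w = ((1 / 2 : ℝ) • hermIm n (diagOp a v)) w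
  rw [map_smul, hermRe_I_div_two_smul]

theorem hermRe_I_div_two_smul_self (v : EuclideanSpace ℂ (Fin n)) :
    hermRe n ((Complex.I / 2) • v) ((Complex.I / 2) • v) = ‖v‖ ^ 2 / 4 := by
  rw [hermRe_apply, show ∀ u : EuclideanSpace ℂ (Fin n), (inner ℂ u u).re = ‖u‖ ^ 2 from
    fun u => inner_self_eq_norm_sq (𝕜 := ℂ) u, norm_smul, mul_pow]
  simp
  ring

/-- Termwise |z_i|² ≤ m |z_i|²/a_i, and the right-hand sides sum to m. The points √a_j e_j below
attain the bound when m = a_j. -/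
theorem norm_sq_le_of_mem_ellipsoid {a : Fin n → ℝ} {ha : ∀ i, 0 < a i} {m : ℝ}
    (hm : ∀ i, a i ≤ m) (z : ellipsoid a ha) : ‖(z : EuclideanSpace ℂ (Fin n))‖ ^ 2 ≤ m := by
  have hz : ∑ i, ‖(z : EuclideanSpace ℂ (Fin n)) i‖ ^ 2 / a i = 1 := z.2
  rw [EuclideanSpace.norm_sq_eq, ← mul_one m, ← hz, Finset.mul_sum]
  refine Finset.sum_le_sum fun i _ => ?_
  rw [mul_div_assoc', le_div_iff₀ (ha i), mul_comm]
  exact mul_le_mul_of_nonneg_right (hm i) (sq_nonneg _)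

theorem single_mem_ellipsoid (a : Fin n → ℝ) (ha : ∀ i, 0 < a i) (j : Fin n) :
    EuclideanSpace.single j (√(a j) : ℂ) ∈ ellipsoid a ha := by
  change ∑ i, ‖EuclideanSpace.single j (√(a j) : ℂ) i‖ ^ 2 / a i = 1
  rw [Finset.sum_eq_single j]
  · simp [abs_of_nonneg (Real.sqrt_nonneg _), Real.sq_sqrt (ha j).le, (ha j).ne']
  · intro i _ hij
    simp [hij]
  · simp

theorem norm_sq_single_sqrt (a : Fin n → ℝ) (ha : ∀ i, 0 < a i) (j : Fin n) :
    ‖EuclideanSpace.single j (√(a j) : ℂ)‖ ^ 2 = a j := by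
  simp [abs_of_nonneg (Real.sqrt_nonneg _), Real.sq_sqrt (ha j).le]

/-! ### The rotation flow on the sphere and the ellipsoid -/

variable [NeZero n]

/-- The flow `z ↦ e^{it/2} z` on the unit sphere. -/
noncomputable def sphereFlow (n : ℕ) [NeZero n] (t : ℝ) :
    Diffeomorph (𝓡 (2 * n - 1)) (𝓡 (2 * n - 1)) (unitSphere n) (unitSphere n) ∞ where
  toFun z := ⟨halfRotation n t z, by simp [norm_halfRotation]⟩
  invFun z := ⟨halfRotation n (-t) z, by simp [norm_halfRotation]⟩
  left_inv z := Subtype.ext <| by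
    change halfRotation n (-t) (halfRotation n t z) = z
    rw [← halfRotation_add, neg_add_cancel, halfRotation_zero]
  right_inv z := Subtype.ext <| by
    change halfRotation n t (halfRotation n (-t) z) = z
    rw [← halfRotation_add, add_neg_cancel, halfRotation_zero]
  contMDiff_toFun := ((halfRotation n t).contMDiff.comp contMDiff_coe_sphere).codRestrict_sphere
    fun z => by simp [norm_halfRotation]
  contMDiff_invFun := ((halfRotation n (-t)).contMDiff.comp contMDiff_coe_sphere).codRestrict_sphere
    fun z => by simp [norm_halfRotation]

theorem coe_sphereFlow (t : ℝ) (z : unitSphere n) :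
    (sphereFlow n t z : EuclideanSpace ℂ (Fin n)) = halfRotation n t z := rfl

theorem contMDiff_sphereFlow (z : unitSphere n) :
    ContMDiff 𝓘(ℝ, ℝ) (𝓡 (2 * n - 1)) ∞ fun t => sphereFlow n t z :=
  (contDiff_halfRotation (z : EuclideanSpace ℂ (Fin n))).contMDiff.codRestrict_sphere
    fun t => by simp [norm_halfRotation]

/-- The flow `z ↦ e^{it/2} z` on the ellipsoid. -/
noncomputable def ellipsoidFlow (a : Fin n → ℝ) (ha : ∀ i, 0 < a i) (t : ℝ) :
    Diffeomorph (𝓡 (2 * n - 1)) (𝓡 (2 * n - 1)) (ellipsoid a ha) (ellipsoid a ha) ∞ :=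
  ((ellipsoidDiffeo a ha).symm.trans (sphereFlow n t)).trans (ellipsoidDiffeo a ha)

/-- The flow is defined by conjugating the sphere flow with √A, which supplies its smoothness. Since
√A is complex linear, the conjugate is again the scalar rotation. -/
theorem coe_ellipsoidFlow (a : Fin n → ℝ) (ha : ∀ i, 0 < a i) (t : ℝ) (z : ellipsoid a ha) :
    (ellipsoidFlow a ha t z : EuclideanSpace ℂ (Fin n)) = halfRotation n t z := by
  have h : (z : EuclideanSpace ℂ (Fin n)) =
      diagOp (fun i => √(a i)) ((ellipsoidDiffeo a ha).symm z) :=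
    congrArg Subtype.val ((ellipsoidDiffeo a ha).apply_symm_apply z).symm
  rw [h, ← diagOp_halfRotation]
  rfl

theorem contMDiff_ellipsoidFlow (a : Fin n → ℝ) (ha : ∀ i, 0 < a i) (z : ellipsoid a ha) :
    ContMDiff 𝓘(ℝ, ℝ) (𝓡 (2 * n - 1)) ∞ fun t => ellipsoidFlow a ha t z :=
  (ellipsoidDiffeo a ha).contMDiff.comp (contMDiff_sphereFlow ((ellipsoidDiffeo a ha).symm z))

theorem sphereFlow_zero (z : unitSphere n) : sphereFlow n 0 z = z :=
  Subtype.ext (halfRotation_zero _)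

theorem ellipsoidFlow_zero (a : Fin n → ℝ) (ha : ∀ i, 0 < a i) (z : ellipsoid a ha) :
    ellipsoidFlow a ha 0 z = z :=
  Subtype.ext ((coe_ellipsoidFlow a ha 0 z).trans (halfRotation_zero _))

theorem hasDerivAt_sphereFlow (z : unitSphere n) (t : ℝ) :
    HasDerivAt (fun s => (sphereFlow n s z : EuclideanSpace ℂ (Fin n)))
      ((Complex.I / 2) • (sphereFlow n t z : EuclideanSpace ℂ (Fin n))) t :=
  hasDerivAt_halfRotation _ t

theorem hasDerivAt_ellipsoidFlow (a : Fin n → ℝ) (ha : ∀ i, 0 < a i) (z : ellipsoid a ha) (t : ℝ) :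
    HasDerivAt (fun s => (ellipsoidFlow a ha s z : EuclideanSpace ℂ (Fin n)))
      ((Complex.I / 2) • (ellipsoidFlow a ha t z : EuclideanSpace ℂ (Fin n))) t := by
  simp only [coe_ellipsoidFlow]
  exact hasDerivAt_halfRotation _ t

theorem isKilling_sphereSystem (a : Fin n → ℝ) (ha : ∀ i, 0 < a i) :
    (sphereSystem a ha).IsKilling :=
  ⟨velocityField (fun t => sphereFlow n t) sphereFlow_zero,
    isDualField_induced (J := fun v => (Complex.I / 2) • v) _ _ _ _ _ _ _
      (mvfderiv_velocityField contMDiff_coe_sphere sphereFlow_zero contMDiff_sphereFlow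
        (J := fun v => (Complex.I / 2) • v) hasDerivAt_sphereFlow)
      (weightedRe_I_div_two_smul a),
    isKillingField_induced _ _ _ _ _ _ _ (sphereFlow n) sphereFlow_zero contMDiff_sphereFlow
      (J := fun v => (Complex.I / 2) • v) coe_sphereFlow (weightedRe_halfRotation a)
      hasDerivAt_sphereFlow⟩

/-- The Hopf field `z ↦ (i/2) z` on the ellipsoid. -/
noncomputable def ellipsoidField (a : Fin n → ℝ) (ha : ∀ i, 0 < a i) (z : ellipsoid a ha) :
    TangentSpace (𝓡 (2 * n - 1)) z :=
  velocityField (fun t => ellipsoidFlow a ha t) (ellipsoidFlow_zero a ha) z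

theorem mvfderiv_ellipsoidField (a : Fin n → ℝ) (ha : ∀ i, 0 < a i) (z : ellipsoid a ha) :
    mvfderiv (𝓡 (2 * n - 1)) ((↑) : ellipsoid a ha → EuclideanSpace ℂ (Fin n)) z
      (ellipsoidField a ha z) = (Complex.I / 2) • (z : EuclideanSpace ℂ (Fin n)) :=
  mvfderiv_velocityField (contMDiff_coe_ellipsoid a ha) (ellipsoidFlow_zero a ha)
    (contMDiff_ellipsoidFlow a ha) (J := fun v => (Complex.I / 2) • v)
    (hasDerivAt_ellipsoidFlow a ha) z

theorem isDualField_ellipsoidField (a : Fin n → ℝ) (ha : ∀ i, 0 < a i) :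
    (ellipsoidSystem a ha).IsDualField (ellipsoidField a ha) :=
  isDualField_induced (J := fun v => (Complex.I / 2) • v) _ _ _ _ _ _ _
    (mvfderiv_ellipsoidField a ha) hermRe_I_div_two_smul

theorem isKilling_ellipsoidSystem (a : Fin n → ℝ) (ha : ∀ i, 0 < a i) :
    (ellipsoidSystem a ha).IsKilling :=
  ⟨ellipsoidField a ha, isDualField_ellipsoidField a ha,
    isKillingField_induced _ _ _ _ _ _ _ (ellipsoidFlow a ha) (ellipsoidFlow_zero a ha)
      (contMDiff_ellipsoidFlow a ha) (J := fun v => (Complex.I / 2) • v) (coe_ellipsoidFlow a ha)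
      hermRe_halfRotation (hasDerivAt_ellipsoidFlow a ha)⟩

theorem ellipsoidSystem_metric_ellipsoidField (a : Fin n → ℝ) (ha : ∀ i, 0 < a i)
    (z : ellipsoid a ha) :
    (ellipsoidSystem a ha).metric.inner z (ellipsoidField a ha z) (ellipsoidField a ha z)
      = ‖(z : EuclideanSpace ℂ (Fin n))‖ ^ 2 / 4 := by
  rw [← hermRe_I_div_two_smul_self, ← mvfderiv_ellipsoidField a ha z]
  rfl

theorem maneCriticalValue_ellipsoidSystem (a : Fin n → ℝ) (ha : ∀ i, 0 < a i) {j : Fin n}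
    (hj : ∀ i, a i ≤ a j) : (ellipsoidSystem a ha).maneCriticalValue = a j / 8 := by
  -- The extremal loop is the orbit of √a_j e_j over time 4π. Rotation preserves the norm, so |X|² =
  -- a_j/4 = 2·(a_j/8) all along it.
  refine (ellipsoidSystem a ha).maneCriticalValue_eq_of_isDualField
    (isDualField_ellipsoidField a ha) (fun q => ?_)
    (contMDiff_ellipsoidFlow a ha ⟨_, single_mem_ellipsoid a ha j⟩)
    (T := 4 * Real.pi) (by positivity) (fun t => Subtype.ext ?_)
    (mfderiv_orbit_eq_velocityField (Φ := fun t => ellipsoidFlow a ha t)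
      (J := fun v => (Complex.I / 2) • v) (contMDiff_coe_ellipsoid a ha)
      (injective_mvfderiv_coe_ellipsoid a ha) (ellipsoidFlow_zero a ha)
      (contMDiff_ellipsoidFlow a ha) (hasDerivAt_ellipsoidFlow a ha) _) (fun t => ?_)
  · rw [ellipsoidSystem_metric_ellipsoidField]
    linarith [norm_sq_le_of_mem_ellipsoid hj q]
  · rw [coe_ellipsoidFlow, coe_ellipsoidFlow, halfRotation_add, halfRotation_four_pi]
  · rw [ellipsoidSystem_metric_ellipsoidField, coe_ellipsoidFlow, norm_halfRotation,
      norm_sq_single_sqrt a ha]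
    ring

theorem potentialNorm_ellipsoidSystem (a : Fin n → ℝ) (ha : ∀ i, 0 < a i) {j : Fin n}
    (hj : ∀ i, a i ≤ a j) : (ellipsoidSystem a ha).potentialNorm = √(a j / 4) := by
  refine (ellipsoidSystem a ha).potentialNorm_eq_of_isDualField
    (isDualField_ellipsoidField a ha) (fun q => ?_) (q₀ := ⟨_, single_mem_ellipsoid a ha j⟩) ?_
  · rw [ellipsoidSystem_metric_ellipsoidField]
    linarith [norm_sq_le_of_mem_ellipsoid hj q]
  · rw [ellipsoidSystem_metric_ellipsoidField, norm_sq_single_sqrt a ha]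

end Ellipsoid

end Magnetic

theorem mainTheorem10 {n : ℕ} [NeZero n] (a : Fin n → ℝ) (ha : ∀ i, 0 < a i) (hmono : Monotone a) :
    (Magnetic.sphereSystem a ha).IsKilling ∧
    (Magnetic.ellipsoidSystem a ha).IsKilling ∧
    (Magnetic.ellipsoidSystem a ha).maneCriticalValue
      = 1 / 2 * (Magnetic.ellipsoidSystem a ha).potentialNorm ^ 2 ∧
    (Magnetic.ellipsoidSystem a ha).maneCriticalValue
      = a ⟨n - 1, Nat.sub_one_lt (NeZero.ne n)⟩ / 8 := by
  -- Indices start at 0, so the largest weight a_n sits at n − 1.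
  have hj : ∀ i, a i ≤ a ⟨n - 1, Nat.sub_one_lt (NeZero.ne n)⟩ :=
    fun i => hmono (Fin.mk_le_mk.2 (Nat.le_sub_one_of_lt i.2))
  refine ⟨Magnetic.isKilling_sphereSystem a ha, Magnetic.isKilling_ellipsoidSystem a ha, ?_,
    Magnetic.maneCriticalValue_ellipsoidSystem a ha hj⟩
  rw [Magnetic.maneCriticalValue_ellipsoidSystem a ha hj,
    Magnetic.potentialNorm_ellipsoidSystem a ha hj,
    Real.sq_sqrt (div_nonneg (ha _).le (by norm_num))]
  ring
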